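/- Let $p\in(0,1/2)$ and $\rho=p/(1-p)$, and let $P=(p(x,y))_{x,y\in\mathbb N}$ be the transition matrix of the simple random walk on $\mathbb N=\{0,1,2,\dots\}$ reflected at $0$: $p(x,x+1)=p$ for $x\ge 0$, $p(x,x-1)=1-p$ for $x\ge 1$, and $p(0,0)=1-p$. Let $(C_k,M_k)_{k\ge 0}$ be the associated cat and mouse Markov chain on $\mathbb N^2$, whose transition probabilities from a state $(x,y)$ are: if $x\ne y$, it goes to $(z,y)$ with probability $p(x,z)$ (the cat moves, the mouse stays idle); if $x=y$, it goes to $(z,w)$ with probability $p(y,z)\,p(y,w)$ (both move independently). Assume $C_0=M_0=0$. (i) For all real $s,t$ with $0<s<t$, $$\lim_{n\to+\infty}\mathbb P\left(\sup_{s\le u\le t}\frac{M_{\lfloor u\rho^{-n}\rfloor}}{n}\ge\frac12\right)=1 .$$ (ii) Almost surely, $M_k=0$ for infinitely many $k$. Thus the mouse keeps returning to $0$, while on every interval $[s,t]$, $0<s<t$, the supremum of the rescaled process $u\mapsto M_{\lfloor u\rho^{-n}\rfloor}/n$ is at least $1/2$ with probability tending to $1$; in particular, by (i), these suprema do not converge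 to $0$ in probability. -/

import Mathlib

open MeasureTheory Filter Topology

/-- Transition matrix of the simple reflected random walk on `ℕ`: from `x` the walk jumps to
`x + 1` with probability `p`; with probability `1 - p` it jumps to `x - 1` if `x ≠ 0`, and stays
at `0` if `x = 0`. -/
def reflectedWalk (p : ℝ) (x y : ℕ) : ℝ :=
  if y = x + 1 then p
  else if y + 1 = x ∨ (x = 0 ∧ y = 0) then 1 - p
  else 0

/-- Transition matrix of the cat and mouse Markov chain associated with the transition matrix `P`
on `S`. A state is a pair (position of the cat, position of the mouse). If the positions differ,
the cat moves according to `P` and the mouse stays idle; if they agree, both move independently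
according to `P`. -/
def catMouse {S : Type*} [DecidableEq S] (P : S → S → ℝ) (a b : S × S) : ℝ :=
  if a.1 = a.2 then P a.1 b.1 * P a.2 b.2
  else if b.2 = a.2 then P a.1 b.1
  else 0

/-- `Z` is, under the probability measure `μ`, a Markov chain with values in the countable state
space `S`, with transition matrix `Q` and with deterministic starting point `z₀`: each path of
length `n + 1` has the probability of its first `n` steps times the transition probability of its
last step. -/
structure IsMarkovChain {S Ω : Type*} [Countable S] [MeasurableSpace S]
    [DiscreteMeasurableSpace S] [MeasurableSpace Ω]
    (Q : S → S → ℝ) (z₀ : S) (Z : ℕ → Ω → S) (μ : Measure Ω) : Prop where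
  measurable : ∀ k, Measurable (Z k)
  initial : ∀ᵐ ω ∂μ, Z 0 ω = z₀
  step : ∀ (n : ℕ) (z : ℕ → S),
    μ.real {ω | ∀ k ≤ n + 1, Z k ω = z k}
      = μ.real {ω | ∀ k ≤ n, Z k ω = z k} * Q (z n) (z (n + 1))

open scoped ENNReal

/-! Both halves are Foster–Lyapunov drift arguments. The mouse moves only when the cat is on it, so
the test function is a potential `g` of the mouse's position plus a price for the cat's way back
(`catMouseLyapunov`). Off the diagonal the price must fall on average: above the mouse a linear
price does, since the cat drifts down; below it `r ^ y - r ^ x` does, since `r ^ x` is a strict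
submartingale of the reflected walk once `r > 1 / ρ`. On the diagonal the mean decrease of `g` must
pay for the price that a separation creates.

For recurrence, `g y = y`: the mouse's downward drift pays, provided the price from below stays
bounded in `y`. The total drift then decays in `y`, but is bounded below where the Lyapunov function
is bounded, which suffices (`ae_frequently_notMem`).

For the climb to a level `N`, `g y = H * (r ^ N - r ^ y)` up to truncation: it falls at meetings
because `r ^ y` rises on average. The test function is `O(r ^ N)` plus a term controlled by an
exponential moment of the cat, so from any starting time the mouse stays below `N` for `i` steps
with probability `O(r ^ N / i)`. With `θ = 1 / (2p)` and `r = θ ^ 2` one has `θ ^ 2 * ρ > 1` and `θ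
* ρ < 1`; for `N ≈ n / 2`, `r ^ N ≈ θ ^ n` is negligible against the `(t - s) * ρ ^ (-n)` available
steps. -/

/-- The action of a transition matrix on nonnegative functions. -/
noncomputable def transitionOp {S : Type*} (Q : S → S → ℝ) (f : S → ℝ≥0∞) (z : S) : ℝ≥0∞ :=
  ∑' w, ENNReal.ofReal (Q z w) * f w

/-- The event that a process stays in `D` during the times `n, …, n + i`. -/
def stayEvent {S Ω : Type*} (Z : ℕ → Ω → S) (D : Set S) (n i : ℕ) : Set Ω :=
  {ω | ∀ j ≤ i, Z (n + j) ω ∈ D}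

theorem stayEvent_antitone {S Ω : Type*} (Z : ℕ → Ω → S) (D : Set S) (n : ℕ) :
    Antitone (stayEvent Z D n) :=
  fun _ _ hij _ hω k hk => hω k (hk.trans hij)

/-! ### Markov property and drift criteria for general countable chains. -/

section MarkovChain

variable {S Ω : Type*} [Countable S] [MeasurableSpace S] [DiscreteMeasurableSpace S]
  [MeasurableSpace Ω] {Q : S → S → ℝ} {z₀ : S} {Z : ℕ → Ω → S} {μ : Measure Ω}

theorem IsMarkovChain.measurable_comp (h : IsMarkovChain Q z₀ Z μ) (f : S → ℝ≥0∞) (n : ℕ) :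
    Measurable fun ω => f (Z n ω) :=
  (measurable_of_countable f).comp (h.measurable n)

/-- The Markov property, integrated against a function of the past. -/
theorem IsMarkovChain.lintegral_past_mul [IsFiniteMeasure μ] (h : IsMarkovChain Q z₀ Z μ) (n : ℕ)
    (F : (Fin (n + 1) → S) → ℝ≥0∞) (f : S → ℝ≥0∞) :
    ∫⁻ ω, F (fun k => Z k ω) * f (Z (n + 1) ω) ∂μ
      = ∫⁻ ω, F (fun k => Z k ω) * transitionOp Q f (Z n ω) ∂μ := by
  have hpre : Measurable (fun ω => (fun k : Fin (n + 1) => Z k ω)) :=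
    measurable_pi_lambda _ fun k => h.measurable k
  have hpair : Measurable (fun ω => ((fun k : Fin (n + 1) => Z k ω), Z (n + 1) ω)) :=
    hpre.prodMk (h.measurable _)
  have h1 : ∫⁻ ω, F (fun k => Z k ω) * f (Z (n + 1) ω) ∂μ
      = ∫⁻ x, F x.1 * f x.2 ∂(μ.map fun ω => ((fun k : Fin (n + 1) => Z k ω), Z (n + 1) ω)) :=
    (lintegral_map (f := fun x : (Fin (n + 1) → S) × S => F x.1 * f x.2)
      (measurable_of_countable _) hpair).symm
  have h2 : ∫⁻ ω, F (fun k => Z k ω) * transitionOp Q f (Z n ω) ∂μ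
      = ∫⁻ x, F x * transitionOp Q f (x (Fin.last n))
          ∂(μ.map fun ω => (fun k : Fin (n + 1) => Z k ω)) :=
    (lintegral_map (f := fun x : Fin (n + 1) → S => F x * transitionOp Q f (x (Fin.last n)))
      (measurable_of_countable _) hpre).symm
  -- The space of pasts is countable, so both integrals are sums over paths and can be compared path
  -- by path.
  rw [h1, h2, lintegral_countable', lintegral_countable', ENNReal.tsum_prod']
  refine tsum_congr fun π => ?_
  rw [transitionOp, ← ENNReal.tsum_mul_left, ← ENNReal.tsum_mul_right]
  refine tsum_congr fun w => ?_
  rw [Measure.map_apply hpair (measurableSet_singleton _),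
    Measure.map_apply hpre (measurableSet_singleton _)]
  let z : ℕ → S := fun k => if hk : k < n + 1 then π ⟨k, hk⟩ else w
  have e1 : (fun ω => ((fun k : Fin (n + 1) => Z k ω), Z (n + 1) ω)) ⁻¹' {(π, w)}
      = {ω | ∀ k ≤ n + 1, Z k ω = z k} := by
    ext ω
    simp only [Set.mem_preimage, Set.mem_singleton_iff, Prod.mk.injEq, Set.mem_ofPred_eq, z]
    constructor
    · rintro ⟨a, b⟩ k hk
      by_cases hk' : k < n + 1
      · simp only [hk', dif_pos]
        exact congrFun a ⟨k, hk'⟩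
      · obtain rfl : k = n + 1 := by omega
        simpa using b
    · intro a
      refine ⟨funext fun k => ?_, ?_⟩
      · have := a k (by omega)
        simpa [k.2] using this
      · simpa using a (n + 1) le_rfl
  have e2 : (fun ω => (fun k : Fin (n + 1) => Z k ω)) ⁻¹' {π} = {ω | ∀ k ≤ n, Z k ω = z k} := by
    ext ω
    simp only [Set.mem_preimage, Set.mem_singleton_iff, Set.mem_ofPred_eq, z]
    constructor
    · intro a k hk
      have hk' : k < n + 1 := by omega
      simp only [hk', dif_pos]
      exact congrFun a ⟨k, hk'⟩
    · intro a
      refine funext fun k => ?_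
      have := a k (by omega)
      simpa [k.2] using this
  have hz : z n = π (Fin.last n) := by simp [z, Fin.last]
  have hz' : z (n + 1) = w := by simp [z]
  have hs := congrArg ENNReal.ofReal (h.step n z)
  rw [ENNReal.ofReal_mul measureReal_nonneg, ofReal_measureReal, ofReal_measureReal, hz, hz'] at hs
  rw [e1, e2, hs]
  ring

theorem IsMarkovChain.lintegral_succ [IsFiniteMeasure μ] (h : IsMarkovChain Q z₀ Z μ) (n : ℕ)
    (f : S → ℝ≥0∞) : ∫⁻ ω, f (Z (n + 1) ω) ∂μ = ∫⁻ ω, transitionOp Q f (Z n ω) ∂μ := by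
  simpa using h.lintegral_past_mul n (fun _ => 1) f

theorem IsMarkovChain.lintegral_zero [IsProbabilityMeasure μ] (h : IsMarkovChain Q z₀ Z μ)
    (f : S → ℝ≥0∞) : ∫⁻ ω, f (Z 0 ω) ∂μ = f z₀ := by
  rw [lintegral_congr_ae (h.initial.mono fun ω hω => congrArg f hω)]
  simp

/-- A function growing by at most a constant on average in each step is integrable. -/
theorem IsMarkovChain.lintegral_ne_top_of_transitionOp_le_add [IsProbabilityMeasure μ]
    (h : IsMarkovChain Q z₀ Z μ) {f : S → ℝ≥0∞} (h0 : f z₀ ≠ ∞) {c : ℝ≥0∞} (hc : c ≠ ∞)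
    (hf : ∀ z, transitionOp Q f z ≤ f z + c) (n : ℕ) : ∫⁻ ω, f (Z n ω) ∂μ ≠ ∞ := by
  induction n with
  | zero => rwa [h.lintegral_zero]
  | succ n ih =>
    rw [h.lintegral_succ]
    refine ne_top_of_le_ne_top (ENNReal.add_ne_top.2 ⟨ih, hc⟩) ((lintegral_mono fun ω => hf _).trans ?_)
    rw [lintegral_add_right _ measurable_const]
    simp

/-- A function satisfying a geometric drift condition has bounded expectations. -/
theorem IsMarkovChain.lintegral_le_of_transitionOp_le [IsProbabilityMeasure μ]
    (h : IsMarkovChain Q z₀ Z μ) {f : S → ℝ≥0∞} {γ c B : ℝ≥0∞} (h0 : f z₀ ≤ B)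
    (hB : γ * B + c ≤ B) (hf : ∀ z, transitionOp Q f z ≤ γ * f z + c) (n : ℕ) :
    ∫⁻ ω, f (Z n ω) ∂μ ≤ B := by
  induction n with
  | zero => rwa [h.lintegral_zero]
  | succ n ih =>
    rw [h.lintegral_succ]
    refine ((lintegral_mono fun ω => hf _).trans ?_).trans hB
    rw [lintegral_add_right _ measurable_const,
      lintegral_const_mul _ (h.measurable_comp f n)]
    simp only [lintegral_const, measure_univ, mul_one]
    gcongr

theorem IsMarkovChain.measurableSet_stayEvent (h : IsMarkovChain Q z₀ Z μ) (D : Set S) (n i : ℕ) :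
    MeasurableSet (stayEvent Z D n i) := by
  have : stayEvent Z D n i = ⋂ j ∈ Set.Iic i, Z (n + j) ⁻¹' D := by
    ext ω; simp [stayEvent]
  rw [this]
  exact MeasurableSet.biInter (Set.to_countable _)
    fun j _ => h.measurable _ (MeasurableSet.of_discrete)

theorem IsMarkovChain.setLIntegral_stayEvent [IsFiniteMeasure μ] (h : IsMarkovChain Q z₀ Z μ)
    (D : Set S) (n i : ℕ) (f : S → ℝ≥0∞) :
    ∫⁻ ω in stayEvent Z D n i, f (Z (n + i + 1) ω) ∂μ
      = ∫⁻ ω in stayEvent Z D n i, transitionOp Q f (Z (n + i) ω) ∂μ := by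
  classical
  have key : ∀ (g : Ω → ℝ≥0∞) (ω : Ω), (stayEvent Z D n i).indicator g ω
      = (fun x : Fin (n + i + 1) → S =>
          if ∀ k : Fin (n + i + 1), n ≤ k → x k ∈ D then (1 : ℝ≥0∞) else 0) (fun k => Z k ω)
        * g ω := by
    intro g ω
    have : ω ∈ stayEvent Z D n i ↔ ∀ k : Fin (n + i + 1), n ≤ (k : ℕ) → Z k ω ∈ D := by
      constructor
      · intro hω k hk
        have := hω (k - n) (by omega)
        rwa [Nat.add_sub_cancel' hk] at this
      · intro hω j hj
        exact hω ⟨n + j, by omega⟩ (by simp)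
    by_cases hω : ω ∈ stayEvent Z D n i
    · rw [Set.indicator_of_mem hω]
      simp only [if_pos (this.1 hω), one_mul]
    · rw [Set.indicator_of_notMem hω]
      simp only [if_neg (fun h' => hω (this.2 h')), zero_mul]
  rw [← lintegral_indicator (h.measurableSet_stayEvent D n i),
    ← lintegral_indicator (h.measurableSet_stayEvent D n i)]
  simp only [key]
  exact h.lintegral_past_mul (n + i)
    (fun x => if ∀ k : Fin (n + i + 1), n ≤ (k : ℕ) → x k ∈ D then 1 else 0) f

/-- Foster–Lyapunov drift inequality for the time spent in `D` before leaving it. -/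
theorem IsMarkovChain.sum_setLIntegral_add_le [IsFiniteMeasure μ] (h : IsMarkovChain Q z₀ Z μ)
    {D : Set S} {V ε : S → ℝ≥0∞} (hV : ∀ z ∈ D, transitionOp Q V z + ε z ≤ V z) (n i : ℕ) :
    ∑ j ∈ Finset.range i, ∫⁻ ω in stayEvent Z D n j, ε (Z (n + j) ω) ∂μ
      + ∫⁻ ω in stayEvent Z D n i, V (Z (n + i) ω) ∂μ ≤ ∫⁻ ω, V (Z n ω) ∂μ := by
  induction i with
  | zero => simpa using setLIntegral_le_lintegral _ _
  | succ i ih =>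
    refine le_trans ?_ ih
    rw [Finset.sum_range_succ, add_assoc]
    refine add_le_add le_rfl ?_
    calc _ ≤ ∫⁻ ω in stayEvent Z D n i, ε (Z (n + i) ω) ∂μ
          + ∫⁻ ω in stayEvent Z D n i, V (Z (n + i + 1) ω) ∂μ := by
          refine add_le_add le_rfl ?_
          exact lintegral_mono_set (stayEvent_antitone Z D n i.le_succ)
      _ = ∫⁻ ω in stayEvent Z D n i, (ε (Z (n + i) ω) + transitionOp Q V (Z (n + i) ω)) ∂μ := by
          rw [h.setLIntegral_stayEvent,
            lintegral_add_left (h.measurable_comp ε _)]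
      _ ≤ _ := by
          refine setLIntegral_mono (h.measurable_comp V _) ?_
          intro ω hω
          rw [add_comm]
          exact hV _ (hω i le_rfl)

/-- If `V` decreases by one on average in each step from `D`, then staying in `D` for `i` steps
has probability at most `𝔼 V / i`. -/
theorem IsMarkovChain.mul_measure_stayEvent_le [IsFiniteMeasure μ] (h : IsMarkovChain Q z₀ Z μ)
    {D : Set S} {V : S → ℝ≥0∞} (hV : ∀ z ∈ D, transitionOp Q V z + 1 ≤ V z) (n i : ℕ) :
    ((i + 1 : ℕ) : ℝ≥0∞) * μ (stayEvent Z D n i) ≤ ∫⁻ ω, V (Z n ω) ∂μ := by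
  refine le_trans ?_ ((le_add_right le_rfl).trans (h.sum_setLIntegral_add_le hV n (i + 1)))
  simp only [setLIntegral_const, one_mul]
  calc ((i + 1 : ℕ) : ℝ≥0∞) * μ (stayEvent Z D n i)
      = ∑ _j ∈ Finset.range (i + 1), μ (stayEvent Z D n i) := by simp
    _ ≤ _ := Finset.sum_le_sum fun j hj =>
        measure_mono (stayEvent_antitone Z D n (Finset.mem_range_succ_iff.1 hj))

/-- Recurrence criterion: the complement of `D` is visited infinitely often if some `V` strictly
decreases on average on `D`, uniformly on the part of `D` where `V` is bounded. -/
theorem IsMarkovChain.ae_frequently_notMem [IsFiniteMeasure μ] (h : IsMarkovChain Q z₀ Z μ)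
    {D : Set S} {V ε : S → ℝ≥0∞} (hV : ∀ z ∈ D, transitionOp Q V z + ε z ≤ V z)
    (hint : ∀ n, ∫⁻ ω, V (Z n ω) ∂μ ≠ ∞)
    (hε : ∀ L : ℕ, ∃ e : ℝ≥0∞, e ≠ 0 ∧ e ≠ ∞ ∧ ∀ z ∈ D, V z ≤ L → e ≤ ε z) :
    ∀ᵐ ω ∂μ, ∃ᶠ k in atTop, Z k ω ∉ D := by
  have hnull : ∀ n, μ {ω | ∀ j, Z (n + j) ω ∈ D} = 0 := by
    intro n
    set E := ∫⁻ ω, V (Z n ω) ∂μ with hE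
    have hbound : ∀ L : ℕ, L ≠ 0 → μ {ω | ∀ j, Z (n + j) ω ∈ D} ≤ E / L := by
      intro L hL
      obtain ⟨e, he0, he, hle⟩ := hε L
      -- While the chain stays in `D`, either `V ≤ L`, where `ε ≥ e`, or `V > L`. The first case has
      -- vanishing weight because the `ε`-masses are summable; Markov's inequality bounds the second
      -- by `E / L`. Then `L` tends to infinity.
      have hlim : Tendsto (fun i => (∫⁻ ω in stayEvent Z D n i, ε (Z (n + i) ω) ∂μ) / e + E / L)
          atTop (𝓝 (0 / e + E / L)) := by
        refine Tendsto.add_const _ (ENNReal.Tendsto.div_const ?_ (Or.inr he0))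
        refine ENNReal.tendsto_atTop_zero_of_tsum_ne_top (ne_top_of_le_ne_top (hint n) ?_)
        rw [ENNReal.tsum_eq_iSup_nat]
        exact iSup_le fun i => (le_add_right le_rfl).trans (h.sum_setLIntegral_add_le hV n i)
      rw [ENNReal.zero_div, zero_add] at hlim
      refine ge_of_tendsto' hlim fun i => ?_
      have hm : ∀ f : S → ℝ≥0∞, Measurable fun ω => f (Z (n + i) ω) :=
        fun f => h.measurable_comp f _
      calc μ {ω | ∀ j, Z (n + j) ω ∈ D} ≤ μ (stayEvent Z D n i) :=
            measure_mono fun ω hω j _ => hω j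
        _ = ∫⁻ ω in stayEvent Z D n i, 1 ∂μ := by simp
        _ ≤ ∫⁻ ω in stayEvent Z D n i, (ε (Z (n + i) ω) / e + V (Z (n + i) ω) / L) ∂μ := by
            refine setLIntegral_mono (hm fun z => ε z / e + V z / L) fun ω hω => ?_
            by_cases hc : V (Z (n + i) ω) ≤ L
            · refine le_add_right ?_
              rw [ENNReal.le_div_iff_mul_le (Or.inl he0) (Or.inl he), one_mul]
              exact hle _ (hω i le_rfl) hc
            · refine le_add_left ?_
              rw [ENNReal.le_div_iff_mul_le (Or.inl (by simpa using hL)) (Or.inl (by simp)),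
                one_mul]
              exact (not_le.1 hc).le
        _ = (∫⁻ ω in stayEvent Z D n i, ε (Z (n + i) ω) ∂μ) / e
            + (∫⁻ ω in stayEvent Z D n i, V (Z (n + i) ω) ∂μ) / L := by
            simp only [div_eq_mul_inv]
            rw [lintegral_add_left (hm fun z => ε z * e⁻¹), lintegral_mul_const _ (hm ε),
              lintegral_mul_const _ (hm V)]
        _ ≤ _ := by
            gcongr
            exact (le_add_left le_rfl).trans (h.sum_setLIntegral_add_le hV n i)
    have hlim : Tendsto (fun L : ℕ => E / L) atTop (𝓝 0) := by
      simpa using ENNReal.Tendsto.const_div ENNReal.tendsto_nat_nhds_top (Or.inr (hint n))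
    exact le_antisymm (ge_of_tendsto hlim ((eventually_ne_atTop 0).mono hbound)) bot_le
  have : ∀ᵐ ω ∂μ, ∀ n, ∃ j, Z (n + j) ω ∉ D := by
    refine ae_all_iff.2 fun n => ?_
    rw [ae_iff]
    simpa using hnull n
  filter_upwards [this] with ω hω
  refine frequently_atTop.2 fun n => ?_
  obtain ⟨j, hj⟩ := hω n
  exact ⟨n + j, Nat.le_add_right _ _, hj⟩

end MarkovChain

/-! ### One-step means of the reflected walk and of the cat and mouse chain. -/

theorem transitionOp_reflectedWalk (p : ℝ) (f : ℕ → ℝ≥0∞) (x : ℕ) :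
    transitionOp (reflectedWalk p) f x
      = ENNReal.ofReal p * f (x + 1) + ENNReal.ofReal (1 - p) * f (x - 1) := by
  have : ∀ w, ENNReal.ofReal (reflectedWalk p x w) * f w
      = (if w = x + 1 then ENNReal.ofReal p * f (x + 1) else 0)
        + (if w = x - 1 then ENNReal.ofReal (1 - p) * f (x - 1) else 0) := by
    intro w
    rw [reflectedWalk]
    by_cases h1 : w = x + 1
    · have h2 : ¬ w = x - 1 := by omega
      rw [if_pos h1, if_pos h1, if_neg h2, add_zero, h1]
    · by_cases h2 : w = x - 1
      · have h3 : w + 1 = x ∨ (x = 0 ∧ w = 0) := by omega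
        rw [if_neg h1, if_pos h3, if_neg h1, if_pos h2, zero_add, h2]
      · have h3 : ¬ (w + 1 = x ∨ (x = 0 ∧ w = 0)) := by omega
        simp [h1, h2, h3]
  simp only [transitionOp, this]
  rw [ENNReal.tsum_add, tsum_ite_eq, tsum_ite_eq]

theorem transitionOp_catMouse_of_ne {S : Type*} [DecidableEq S] (P : S → S → ℝ)
    (f : S × S → ℝ≥0∞) {x y : S} (h : x ≠ y) :
    transitionOp (catMouse P) f (x, y) = transitionOp P (fun u => f (u, y)) x := by
  rw [transitionOp, ENNReal.tsum_prod']
  refine tsum_congr fun u => ?_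
  rw [tsum_eq_single y]
  · simp [catMouse, h]
  · intro v hv
    simp [catMouse, h, hv]

theorem transitionOp_catMouse_self {S : Type*} [DecidableEq S] {P : S → S → ℝ}
    (hP : ∀ x y, 0 ≤ P x y) (f : S × S → ℝ≥0∞) (x : S) :
    transitionOp (catMouse P) f (x, x)
      = transitionOp P (fun u => transitionOp P (fun v => f (u, v)) x) x := by
  rw [transitionOp, ENNReal.tsum_prod']
  refine tsum_congr fun u => ?_
  change _ = ENNReal.ofReal (P x u) * ∑' v, ENNReal.ofReal (P x v) * f (u, v)
  rw [← ENNReal.tsum_mul_left]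
  refine tsum_congr fun v => ?_
  simp [catMouse, ENNReal.ofReal_mul (hP x u), mul_assoc]

theorem reflectedWalk_nonneg {p : ℝ} (hp0 : 0 ≤ p) (hp1 : p ≤ 1) (x y : ℕ) :
    0 ≤ reflectedWalk p x y := by
  rw [reflectedWalk]
  split_ifs <;> linarith

theorem transitionOp_reflectedWalk_ofReal {p : ℝ} (hp0 : 0 ≤ p) (hp1 : p ≤ 1) {f : ℕ → ℝ}
    (hf : ∀ x, 0 ≤ f x) (x : ℕ) :
    transitionOp (reflectedWalk p) (fun u => ENNReal.ofReal (f u)) x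
      = ENNReal.ofReal (p * f (x + 1) + (1 - p) * f (x - 1)) := by
  rw [transitionOp_reflectedWalk, ENNReal.ofReal_add (mul_nonneg hp0 (hf _))
    (mul_nonneg (sub_nonneg.2 hp1) (hf _)), ENNReal.ofReal_mul hp0,
    ENNReal.ofReal_mul (sub_nonneg.2 hp1)]

/-- The mean of `f` after one step of the cat and mouse chain driven by the reflected walk. -/
def catMouseMean (p : ℝ) (f : ℕ × ℕ → ℝ) (z : ℕ × ℕ) : ℝ :=
  if z.1 = z.2 then
    p * (p * f (z.1 + 1, z.1 + 1) + (1 - p) * f (z.1 + 1, z.1 - 1))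
      + (1 - p) * (p * f (z.1 - 1, z.1 + 1) + (1 - p) * f (z.1 - 1, z.1 - 1))
  else p * f (z.1 + 1, z.2) + (1 - p) * f (z.1 - 1, z.2)

theorem catMouseMean_nonneg {p : ℝ} (hp0 : 0 ≤ p) (hp1 : p ≤ 1) {f : ℕ × ℕ → ℝ}
    (hf : ∀ z, 0 ≤ f z) (z : ℕ × ℕ) : 0 ≤ catMouseMean p f z := by
  have hq : 0 ≤ 1 - p := sub_nonneg.2 hp1
  have key : ∀ u v : ℝ, 0 ≤ u → 0 ≤ v → 0 ≤ p * u + (1 - p) * v := fun u v hu hv =>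
    add_nonneg (mul_nonneg hp0 hu) (mul_nonneg hq hv)
  rw [catMouseMean]
  split_ifs
  · exact key _ _ (key _ _ (hf _) (hf _)) (key _ _ (hf _) (hf _))
  · exact key _ _ (hf _) (hf _)

theorem transitionOp_catMouse_ofReal {p : ℝ} (hp0 : 0 ≤ p) (hp1 : p ≤ 1) {f : ℕ × ℕ → ℝ}
    (hf : ∀ z, 0 ≤ f z) (z : ℕ × ℕ) :
    transitionOp (catMouse (reflectedWalk p)) (fun w => ENNReal.ofReal (f w)) z
      = ENNReal.ofReal (catMouseMean p f z) := by
  obtain ⟨x, y⟩ := z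
  rw [catMouseMean]
  by_cases h : x = y
  · subst h
    rw [transitionOp_catMouse_self (reflectedWalk_nonneg hp0 hp1), if_pos rfl]
    simp only [transitionOp_reflectedWalk_ofReal hp0 hp1 (fun v => hf (_, v))]
    exact transitionOp_reflectedWalk_ofReal hp0 hp1
      (f := fun u => p * f (u, x + 1) + (1 - p) * f (u, x - 1))
      (fun u => add_nonneg (mul_nonneg hp0 (hf _)) (mul_nonneg (sub_nonneg.2 hp1) (hf _))) x
  · rw [transitionOp_catMouse_of_ne _ _ h, if_neg h]
    exact transitionOp_reflectedWalk_ofReal hp0 hp1 (f := fun u => f (u, y)) (fun u => hf _) x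

/-! ### Lyapunov functions and their one-step drift. -/

/-- Lyapunov functions for the cat and mouse chain: a potential `g` of the mouse plus a cost for
the cat to reach the mouse, linear when the cat is above and exponential when it is below. -/
noncomputable def catMouseLyapunov (a r : ℝ) (b g : ℕ → ℝ) (z : ℕ × ℕ) : ℝ :=
  g z.2 + if z.1 < z.2 then b z.2 * (r ^ z.2 - r ^ z.1) else a * ((z.1 : ℝ) - z.2)

section Lyapunov

variable {p a r κ : ℝ} {b g : ℕ → ℝ}

theorem le_catMouseLyapunov (ha : 0 ≤ a) (hr : 1 ≤ r) (hb : ∀ y, 0 ≤ b y) (z : ℕ × ℕ) :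
    g z.2 ≤ catMouseLyapunov a r b g z := by
  rw [catMouseLyapunov]
  refine le_add_of_nonneg_right ?_
  split_ifs with h
  · exact mul_nonneg (hb _) (sub_nonneg.2 (pow_le_pow_right₀ hr h.le))
  · exact mul_nonneg ha (sub_nonneg.2 (by exact_mod_cast not_lt.1 h))

/-- From `m + 1`, the mean of `r ^ x` rises by `r ^ m * ((r - 1) * (p * r - (1 - p)))`; from `0`, by
`p * (r - 1)`. Both are at least `κ`. -/
theorem catMouseMean_lyapunov_of_lt (hr : 1 ≤ r) (hb : ∀ y, 0 ≤ b y) (hκ : 0 ≤ κ)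
    (hκ1 : κ ≤ (r - 1) * (p * r - (1 - p))) (hκ2 : κ ≤ p * (r - 1)) {x y : ℕ} (h : x < y) :
    catMouseMean p (catMouseLyapunov a r b g) (x, y) + b y * κ
      ≤ catMouseLyapunov a r b g (x, y) := by
  -- If the step reaches the mouse the definition changes branch, but both prices vanish on the
  -- diagonal.
  have hup : catMouseLyapunov a r b g (x + 1, y) = g y + b y * (r ^ y - r ^ (x + 1)) := by
    rcases (Nat.succ_le_of_lt h).lt_or_eq with h' | rfl
    · simp [catMouseLyapunov, h']
    · simp [catMouseLyapunov]
  have hx : catMouseLyapunov a r b g (x, y) = g y + b y * (r ^ y - r ^ x) := by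
    simp [catMouseLyapunov, h]
  have hdown : catMouseLyapunov a r b g (x - 1, y) = g y + b y * (r ^ y - r ^ (x - 1)) := by
    simp [catMouseLyapunov, show x - 1 < y by omega]
  rw [catMouseMean, if_neg h.ne, hx]
  simp only [hup, hdown]
  rcases x with _ | m
  · have := mul_le_mul_of_nonneg_left hκ2 (hb y)
    simp only [zero_add, pow_one, pow_zero, Nat.zero_sub]
    linarith
  · have h1 : κ ≤ r ^ m * ((r - 1) * (p * r - (1 - p))) :=
      hκ1.trans (le_mul_of_one_le_left (hκ.trans hκ1) (one_le_pow₀ hr))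
    have := mul_le_mul_of_nonneg_left h1 (hb y)
    simp only [Nat.add_sub_cancel, pow_succ]
    linarith

theorem catMouseMean_lyapunov_of_gt {x y : ℕ} (h : y < x) :
    catMouseMean p (catMouseLyapunov a r b g) (x, y) + a * (1 - 2 * p)
      = catMouseLyapunov a r b g (x, y) := by
  obtain ⟨m, rfl⟩ : ∃ m, x = m + 1 := ⟨x - 1, by omega⟩
  rw [catMouseMean, if_neg h.ne']
  simp only [catMouseLyapunov, Nat.add_sub_cancel, if_neg (show ¬ m + 1 + 1 < y by omega),
    if_neg (show ¬ m < y by omega), if_neg (show ¬ m + 1 < y by omega)]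
  push_cast
  ring

theorem catMouseMean_lyapunov_zero :
    catMouseMean p (catMouseLyapunov a r b g) (0, 0)
      = p * g 1 + (1 - p) * g 0 + p * (1 - p) * (b 1 * (r - 1) + a) := by
  simp [catMouseMean, catMouseLyapunov]
  ring

/-- A price arises only when the two jumps are opposite: each of the two cases has probability `p *
(1 - p)` and leaves a gap of 2. -/
theorem catMouseMean_lyapunov_succ (m : ℕ) :
    catMouseMean p (catMouseLyapunov a r b g) (m + 1, m + 1)
      = p * g (m + 2) + (1 - p) * g m
        + p * (1 - p) * (b (m + 2) * (r ^ (m + 2) - r ^ m) + 2 * a) := by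
  simp only [catMouseMean, catMouseLyapunov, if_true, Nat.add_sub_cancel, lt_irrefl, if_false,
    if_pos (show m < m + 1 + 1 by omega), if_neg (show ¬ m + 1 + 1 < m by omega)]
  push_cast
  ring_nf

theorem catMouseLyapunov_self (x : ℕ) : catMouseLyapunov a r b g (x, x) = g x := by
  simp [catMouseLyapunov]

end Lyapunov

/-! ### Recurrence of the mouse, moments of the cat, and the climbing time. -/

section CatMouse

variable {Ω : Type*} [MeasurableSpace Ω] {μ : Measure Ω} [IsProbabilityMeasure μ] {p : ℝ}
  {Z : ℕ → Ω → ℕ × ℕ}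

theorem exists_drift_constant {r : ℝ} (hp0 : 0 < p) (hr : 1 < r) (hpr : 1 - p < p * r) :
    ∃ κ > 0, κ ≤ (r - 1) * (p * r - (1 - p)) ∧ κ ≤ p * (r - 1) :=
  ⟨min ((r - 1) * (p * r - (1 - p))) (p * (r - 1)),
    lt_min (mul_pos (by linarith) (by linarith)) (mul_pos hp0 (by linarith)),
    min_le_left _ _, min_le_right _ _⟩

/-- The mouse visits `0` infinitely often. -/
theorem catMouse_ae_frequently_eq_zero {r : ℝ} (hp0 : 0 < p) (hp : p < 1 / 2) (hr : 1 < r)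
    (hpr : 1 - p < p * r) (h : IsMarkovChain (catMouse (reflectedWalk p)) (0, 0) Z μ) :
    ∀ᵐ ω ∂μ, ∃ᶠ k in atTop, (Z k ω).2 = 0 := by
  obtain ⟨κ, hκ, hκ1, hκ2⟩ := exists_drift_constant hp0 hr hpr
  have hr0 : 0 < r := by linarith
  set a : ℝ := 1 - 2 * p with ha_def
  have ha : 0 < a := by linarith
  -- Normalised so that the price from below never exceeds `a`, whatever `y`; the cost is a drift of
  -- only `a * κ * r⁻¹ ^ y` there.
  set b : ℕ → ℝ := fun y => a * r⁻¹ ^ y with hb_def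
  have hb : ∀ y, 0 ≤ b y := fun y => by positivity
  have hbr : ∀ y, b y * r ^ y = a := fun y => by
    rw [hb_def, mul_assoc, ← mul_pow, inv_mul_cancel₀ hr0.ne', one_pow, mul_one]
  set V : ℕ × ℕ → ℝ := catMouseLyapunov a r b (fun y => (y : ℝ)) with hV_def
  have hyV : ∀ z : ℕ × ℕ, (z.2 : ℝ) ≤ V z := le_catMouseLyapunov ha.le hr.le hb
  have hV0 : ∀ z, 0 ≤ V z := fun z => (Nat.cast_nonneg _).trans (hyV z)
  have hpp : p * (1 - p) ≤ 1 / 4 := by nlinarith [sq_nonneg (1 - 2 * p)]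
  have hpp0 : 0 ≤ p * (1 - p) := mul_nonneg hp0.le (by linarith)
  set e : ℝ := min (a * κ) (a * a / 4) with he_def
  have he : 0 < e := lt_min (by positivity) (by positivity)
  have hle : ∀ y, e * r⁻¹ ^ y ≤ a * a / 4 := fun y =>
    (mul_le_of_le_one_right he.le (pow_le_one₀ (by positivity) (inv_le_one_of_one_le₀ hr.le))).trans
      (min_le_right _ _)
  have ha1 : a < 1 := by linarith
  have hoff : ∀ x y : ℕ, x ≠ y → catMouseMean p V (x, y) + e * r⁻¹ ^ y ≤ V (x, y) := by
    intro x y hxy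
    rcases hxy.lt_or_gt with hlt | hgt
    · refine le_trans ?_ (catMouseMean_lyapunov_of_lt hr.le hb hκ.le hκ1 hκ2 hlt)
      have : e * r⁻¹ ^ y ≤ a * κ * r⁻¹ ^ y :=
        mul_le_mul_of_nonneg_right (min_le_left _ _) (by positivity)
      simp only [hb_def]
      linarith
    · have := catMouseMean_lyapunov_of_gt (p := p) (a := a) (r := r) (b := b)
        (g := fun y => (y : ℝ)) hgt
      rw [← ha_def, ← hV_def] at this
      have := hle y
      have : 0 < a * a := by positivity
      linarith
  have hdiag : ∀ m : ℕ, catMouseMean p V (m + 1, m + 1) + e * r⁻¹ ^ (m + 1) ≤ V (m + 1, m + 1) := by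
    intro m
    rw [hV_def, catMouseMean_lyapunov_succ, catMouseLyapunov_self, mul_sub (b (m + 2)), hbr]
    -- The separation price is at most `3 * a / 4`, while the mouse's mean displacement is `-a`: a
    -- net decrease of at least `a / 4`.
    have h1 : p * (1 - p) * (a - b (m + 2) * r ^ m + 2 * a) ≤ 1 / 4 * (3 * a) := by
      have : 0 ≤ b (m + 2) * r ^ m := mul_nonneg (hb _) (by positivity)
      calc _ ≤ p * (1 - p) * (3 * a) := mul_le_mul_of_nonneg_left (by linarith) hpp0
        _ ≤ _ := mul_le_mul_of_nonneg_right hpp (by linarith)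
    have h2 := hle (m + 1)
    have h3 : a * a ≤ a := by nlinarith
    push_cast
    linarith
  have hzero : catMouseMean p V (0, 0) ≤ V (0, 0) + 1 := by
    rw [hV_def, catMouseMean_lyapunov_zero, catMouseLyapunov_self, mul_sub (b 1)]
    have h0 := hbr 1
    rw [pow_one] at h0
    rw [h0]
    have h1 : p * (1 - p) * (a - b 1 * 1 + a) ≤ 1 / 4 * (2 * a) := by
      have := hb 1
      calc _ ≤ p * (1 - p) * (2 * a) := mul_le_mul_of_nonneg_left (by linarith) hpp0
        _ ≤ _ := mul_le_mul_of_nonneg_right hpp (by linarith)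
    push_cast
    linarith
  have hdrift : ∀ z : ℕ × ℕ, z.2 ≠ 0 → catMouseMean p V z + e * r⁻¹ ^ z.2 ≤ V z := by
    rintro ⟨x, y⟩ hy
    by_cases hxy : x = y
    · subst hxy
      obtain ⟨m, rfl⟩ := Nat.exists_eq_succ_of_ne_zero hy
      exact hdiag m
    · exact hoff x y hxy
  have hglobal : ∀ z : ℕ × ℕ, catMouseMean p V z ≤ V z + 1 := by
    rintro ⟨x, y⟩
    have he' : ∀ y, 0 ≤ e * r⁻¹ ^ y := fun y => by positivity
    by_cases hy : y = 0
    · by_cases hx : x = 0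
      · rw [hx, hy]; exact hzero
      · have := hoff x y (by omega)
        have := he' y
        linarith
    · have := hdrift (x, y) hy
      have := he' (x, y).2
      linarith
  have hop := transitionOp_catMouse_ofReal hp0.le (by linarith) hV0
  have key := h.ae_frequently_notMem (D := {z | z.2 ≠ 0}) (V := fun z => ENNReal.ofReal (V z))
    (ε := fun z => ENNReal.ofReal (e * r⁻¹ ^ z.2)) ?_ ?_ ?_
  · simpa using key
  · intro z hz
    rw [hop]
    rw [← ENNReal.ofReal_add (catMouseMean_nonneg hp0.le (by linarith) hV0 z) (by positivity)]
    exact ENNReal.ofReal_le_ofReal (hdrift z hz)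
  · refine h.lintegral_ne_top_of_transitionOp_le_add (f := fun z => ENNReal.ofReal (V z))
      ENNReal.ofReal_ne_top ENNReal.one_ne_top fun z => ?_
    rw [hop, ← ENNReal.ofReal_one, ← ENNReal.ofReal_add (hV0 z) zero_le_one]
    exact ENNReal.ofReal_le_ofReal (hglobal z)
  · intro L
    refine ⟨ENNReal.ofReal (e * r⁻¹ ^ L), ?_, ENNReal.ofReal_ne_top, fun z _ hz => ?_⟩
    · exact (ENNReal.ofReal_pos.2 (by positivity)).ne'
    · refine ENNReal.ofReal_le_ofReal (mul_le_mul_of_nonneg_left ?_ he.le)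
      refine pow_le_pow_of_le_one (by positivity) (inv_le_one_of_one_le₀ hr.le) ?_
      rw [← ENNReal.ofReal_natCast, ENNReal.ofReal_le_ofReal_iff (Nat.cast_nonneg _)] at hz
      exact_mod_cast (hyV z).trans hz

/-- The exponential moments of order `1 / (2p)` of the cat are bounded. -/
theorem exists_lintegral_pow_cat_le (hp0 : 0 < p) (hp : p < 1 / 2)
    (h : IsMarkovChain (catMouse (reflectedWalk p)) (0, 0) Z μ) :
    ∃ B : ℝ, 0 ≤ B ∧
      ∀ n, ∫⁻ ω, ENNReal.ofReal ((1 / (2 * p)) ^ (Z n ω).1) ∂μ ≤ ENNReal.ofReal B := by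
  set θ : ℝ := 1 / (2 * p) with hθ
  have hθ0 : 0 < θ := by positivity
  have hpθ : p * θ = 1 / 2 := by rw [hθ]; field_simp
  set γ : ℝ := 1 / 2 + 2 * p * (1 - p) with hγ_def
  have hγ0 : 0 ≤ γ := by nlinarith
  have hγ : γ < 1 := by nlinarith [mul_pos (show 0 < 1 - 2 * p by linarith) (show 0 < 1 - 2 * p by linarith)]
  have hw : ∀ x : ℕ, p * θ ^ (x + 1) + (1 - p) * θ ^ (x - 1) ≤ γ * θ ^ x + 2 := by
    intro x
    rcases x with _ | m
    · simp only [zero_add, pow_one, pow_zero, Nat.zero_sub]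
      linarith
    · have : p * θ ^ (m + 1 + 1) + (1 - p) * θ ^ (m + 1 - 1) = γ * θ ^ (m + 1) := by
        rw [Nat.add_sub_cancel]
        linear_combination (θ ^ (m + 1) - 2 * (1 - p) * θ ^ m) * hpθ
      linarith
  -- On or off the diagonal, the cat by itself moves as the reflected walk.
  have hmean : ∀ z, catMouseMean p (fun z => θ ^ z.1) z ≤ γ * θ ^ z.1 + 2 := by
    intro z
    refine le_trans (le_of_eq ?_) (hw z.1)
    rw [catMouseMean]
    split_ifs <;> ring
  set B : ℝ := 2 / (1 - γ) + 1 with hB_def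
  have hB2 : 2 / (1 - γ) * (1 - γ) = 2 := div_mul_cancel₀ _ (by linarith)
  have hB1 : 1 ≤ B := le_add_of_nonneg_left (div_nonneg zero_le_two (by linarith))
  refine ⟨B, by linarith, h.lintegral_le_of_transitionOp_le
    (f := fun z => ENNReal.ofReal (θ ^ z.1))
    (γ := ENNReal.ofReal γ) (c := ENNReal.ofReal 2) ?_ ?_ fun z => ?_⟩
  · exact ENNReal.ofReal_le_ofReal (by simpa using hB1)
  · rw [← ENNReal.ofReal_mul hγ0, ← ENNReal.ofReal_add (mul_nonneg hγ0 (by linarith)) zero_le_two]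
    refine ENNReal.ofReal_le_ofReal ?_
    rw [hB_def]
    linarith
  · rw [transitionOp_catMouse_ofReal hp0.le (by linarith) (fun z => by positivity),
      ← ENNReal.ofReal_mul hγ0, ← ENNReal.ofReal_add (by positivity) zero_le_two]
    exact ENNReal.ofReal_le_ofReal (hmean z)

/-- The mouse stays below `N` during `i` steps with probability of order at most `r ^ N / i`,
whatever the starting time. -/
theorem exists_mul_measure_stayEvent_le {r : ℝ} (hp0 : 0 < p) (hp : p < 1 / 2) (hr : 1 < r)
    (hpr : 1 - p < p * r) (h : IsMarkovChain (catMouse (reflectedWalk p)) (0, 0) Z μ) :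
    ∃ c d : ℝ, ∀ N n i : ℕ,
      ((i : ℝ) + 1) * μ.real (stayEvent Z {z | z.2 < N} n i) ≤ c * r ^ N + d := by
  obtain ⟨κ, hκ, hκ1, hκ2⟩ := exists_drift_constant hp0 hr hpr
  obtain ⟨B, hB0, hB⟩ := exists_lintegral_pow_cat_le hp0 hp h
  set θ : ℝ := 1 / (2 * p) with hθ
  have hθ1 : 1 < θ := by rw [hθ, lt_div_iff₀ (by positivity)]; linarith
  have hr0 : 0 < r := by linarith
  have hq : 0 < 1 - 2 * p := by linarith
  set a : ℝ := (1 - 2 * p)⁻¹ with ha_def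
  have ha : 0 < a := by positivity
  have haq : a * (1 - 2 * p) = 1 := inv_mul_cancel₀ hq.ne'
  set K : ℝ := κ⁻¹ with hK_def
  have hK : 0 < K := by positivity
  have hKκ : K * κ = 1 := inv_mul_cancel₀ hκ.ne'
  -- `a` and `K` make the drift at least 1 off the diagonal. `H * κ` is the separation price, up to
  -- a factor `r ^ m`, plus 1, so meetings also gain at least 1.
  set H : ℝ := (K * r ^ 2 + 2 * a + 1) * K with hH_def
  have hH : 0 < H := by positivity
  have hHκ : H * κ = K * r ^ 2 + 2 * a + 1 := by rw [hH_def, mul_assoc, hKκ, mul_one]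
  have hpp0 : 0 ≤ p * (1 - p) := mul_nonneg hp0.le (by linarith)
  have hpp : p * (1 - p) ≤ 1 := by nlinarith
  refine ⟨H + K, a * (θ - 1)⁻¹ * B, fun N n i => ?_⟩
  -- At the starting time `n` the mouse may be above `N`. Truncating `b` and `g` keeps `V` of order
  -- `r ^ N` there, and is harmless for the drift because from below `N` the mouse reaches at most
  -- `N`.
  set b : ℕ → ℝ := fun y => if y ≤ N then K else 0 with hb_def
  set g : ℕ → ℝ := fun y => H * (r ^ N - r ^ min y N) with hg_def
  have hb : ∀ y, 0 ≤ b y := fun y => by rw [hb_def]; dsimp only; split_ifs <;> positivity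
  have hg : ∀ y, 0 ≤ g y := fun y =>
    mul_nonneg hH.le (sub_nonneg.2 (pow_le_pow_right₀ hr.le (min_le_right _ _)))
  have hbK : ∀ y ≤ N, b y = K := fun y hy => if_pos hy
  have hgH : ∀ y ≤ N, g y = H * (r ^ N - r ^ y) := fun y hy => by simp [hg_def, hy]
  set V : ℕ × ℕ → ℝ := catMouseLyapunov a r b g with hV_def
  have hV0 : ∀ z, 0 ≤ V z := fun z => (hg _).trans (le_catMouseLyapunov ha.le hr.le hb z)
  have hdrift : ∀ z : ℕ × ℕ, z.2 < N → catMouseMean p V z + 1 ≤ V z := by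
    rintro ⟨x, y⟩ hy
    replace hy : y < N := hy
    rcases lt_trichotomy x y with hlt | rfl | hgt
    · refine le_trans (le_of_eq ?_) (catMouseMean_lyapunov_of_lt hr.le hb hκ.le hκ1 hκ2 hlt)
      rw [hbK y hy.le, hKκ]
    · rcases x with _ | m
      · rw [hV_def, catMouseMean_lyapunov_zero, catMouseLyapunov_self, hgH 1 hy, hgH 0 hy.le,
          hbK 1 hy]
        have h1 : H * κ ≤ H * (p * (r - 1)) := mul_le_mul_of_nonneg_left hκ2 hH.le
        have h2 : p * (1 - p) * (K * (r - 1) + a) ≤ K * r ^ 2 + 2 * a := by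
          have : 0 ≤ K * (r - 1) := mul_nonneg hK.le (by linarith)
          refine (mul_le_of_le_one_left (by linarith) hpp).trans ?_
          have : K * (r - 1) ≤ K * r ^ 2 := mul_le_mul_of_nonneg_left (by nlinarith) hK.le
          linarith
        simp only [pow_one, pow_zero]
        linarith
      · rw [hV_def, catMouseMean_lyapunov_succ, catMouseLyapunov_self, hgH (m + 2) hy,
          hgH m (by omega), hgH (m + 1) hy.le, hbK (m + 2) hy]
        have hm1 : 1 ≤ r ^ m := one_le_pow₀ hr.le
        have h1 : r ^ m * (H * κ) ≤ r ^ m * (H * ((r - 1) * (p * r - (1 - p)))) :=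
          mul_le_mul_of_nonneg_left (mul_le_mul_of_nonneg_left hκ1 hH.le) (by positivity)
        have h2 : p * (1 - p) * (K * (r ^ (m + 2) - r ^ m) + 2 * a)
            ≤ r ^ m * (K * r ^ 2 + 2 * a) := by
          have h3 : r ^ m ≤ r ^ (m + 2) := pow_le_pow_right₀ hr.le (by omega)
          have h4 : 0 ≤ K * (r ^ (m + 2) - r ^ m) := mul_nonneg hK.le (by linarith)
          refine (mul_le_of_le_one_left (by linarith) hpp).trans ?_
          have h5 : 2 * a ≤ r ^ m * (2 * a) := le_mul_of_one_le_left (by linarith) hm1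
          have h6 : 0 ≤ K * r ^ m := by positivity
          rw [pow_add] at *
          linarith
        rw [hHκ] at h1
        simp only [pow_succ, pow_zero, one_mul] at *
        linarith
    · rw [hV_def, ← catMouseMean_lyapunov_of_gt hgt, haq]
  have hVle : ∀ z, V z ≤ (H + K) * r ^ N + a * (θ - 1)⁻¹ * θ ^ z.1 := by
    rintro ⟨x, y⟩
    have h1 : g y ≤ H * r ^ N := mul_le_mul_of_nonneg_left (sub_le_self _ (by positivity)) hH.le
    have h2 : (x : ℝ) ≤ (θ - 1)⁻¹ * θ ^ x := by
      rw [inv_mul_eq_div, le_div_iff₀ (by linarith)]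
      -- Bernoulli's inequality bounds the linear price by the exponential moment of the cat.
      have := one_add_mul_sub_le_pow (a := θ) (by linarith) x
      linarith
    have h3 : a * x ≤ a * (θ - 1)⁻¹ * θ ^ x := by
      rw [mul_assoc]; exact mul_le_mul_of_nonneg_left h2 ha.le
    have hx : (0 : ℝ) ≤ a * x := by positivity
    have hy : (0 : ℝ) ≤ a * y := by positivity
    have hKN : 0 ≤ K * r ^ N := by positivity
    have h4 : (if x < y then b y * (r ^ y - r ^ x) else a * ((x : ℝ) - y))
        ≤ K * r ^ N + a * x := by
      split_ifs with hxy
      · by_cases hyN : y ≤ N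
        · rw [hbK y hyN]
          have h5 : r ^ y - r ^ x ≤ r ^ N :=
            (sub_le_self _ (by positivity)).trans (pow_le_pow_right₀ hr.le hyN)
          have := mul_le_mul_of_nonneg_left h5 hK.le
          linarith
        · have : b y = 0 := if_neg hyN
          rw [this, zero_mul]
          linarith
      · linarith
    rw [hV_def, catMouseLyapunov]
    dsimp only
    linarith
  have hop := transitionOp_catMouse_ofReal hp0.le (by linarith) hV0
  have key := h.mul_measure_stayEvent_le (D := {z | z.2 < N}) (V := fun z => ENNReal.ofReal (V z))
    (fun z hz => by
      rw [hop, ← ENNReal.ofReal_one, ← ENNReal.ofReal_add (catMouseMean_nonneg hp0.le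
        (by linarith) hV0 z) zero_le_one]
      exact ENNReal.ofReal_le_ofReal (hdrift z hz)) n i
  have hc : 0 ≤ a * (θ - 1)⁻¹ := mul_nonneg ha.le (inv_nonneg.2 (by linarith))
  have hint : ∫⁻ ω, ENNReal.ofReal (V (Z n ω)) ∂μ
      ≤ ENNReal.ofReal ((H + K) * r ^ N + a * (θ - 1)⁻¹ * B) := by
    calc ∫⁻ ω, ENNReal.ofReal (V (Z n ω)) ∂μ
        ≤ ∫⁻ ω, (ENNReal.ofReal ((H + K) * r ^ N)
          + ENNReal.ofReal (a * (θ - 1)⁻¹) * ENNReal.ofReal (θ ^ (Z n ω).1)) ∂μ := by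
          refine lintegral_mono fun ω => ?_
          rw [← ENNReal.ofReal_mul hc, ← ENNReal.ofReal_add (by positivity) (by positivity)]
          exact ENNReal.ofReal_le_ofReal (hVle _)
      _ = ENNReal.ofReal ((H + K) * r ^ N)
          + ENNReal.ofReal (a * (θ - 1)⁻¹) * ∫⁻ ω, ENNReal.ofReal (θ ^ (Z n ω).1) ∂μ := by
          rw [lintegral_add_left measurable_const,
            lintegral_const_mul _ (h.measurable_comp (fun z => ENNReal.ofReal (θ ^ z.1)) n)]
          simp
      _ ≤ _ := by
          rw [ENNReal.ofReal_add (by positivity) (by positivity), ENNReal.ofReal_mul hc]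
          gcongr
          exact hB n
  have hreal := ENNReal.toReal_mono ENNReal.ofReal_ne_top (key.trans hint)
  rw [ENNReal.toReal_mul, ENNReal.toReal_ofReal (by positivity), ENNReal.toReal_natCast,
    Nat.cast_succ] at hreal
  exact hreal

end CatMouse

/-! ### Passage to the rescaled supremum. -/

/-- Below level `1 / 2`, the rescaled supremum forces the path to stay below `n / 2` at all integer
times of the interval. -/
theorem lt_of_sSup_div_lt {m : ℕ → ℕ} {n : ℕ} (hn : 0 < n) {R s t : ℝ} (hR : 0 < R)
    (hsup : sSup ((fun u : ℝ => (m ⌊u * R⌋₊ : ℝ) / (n : ℝ)) '' Set.Icc s t) < 1 / 2)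
    {k : ℕ} (hks : s * R ≤ k) (hkt : (k : ℝ) ≤ t * R) : m k < (n + 1) / 2 := by
  -- Only finitely many integer times occur. Boundedness is needed since `sSup` of an unbounded set
  -- of reals is 0 by default.
  have hbdd : BddAbove ((fun u : ℝ => (m ⌊u * R⌋₊ : ℝ) / (n : ℝ)) '' Set.Icc s t) := by
    refine Set.Finite.bddAbove (((Set.finite_Iic ⌊t * R⌋₊).image
      fun j => (m j : ℝ) / (n : ℝ)).subset ?_)
    rintro _ ⟨u, hu, rfl⟩
    exact ⟨⌊u * R⌋₊, Nat.floor_mono (mul_le_mul_of_nonneg_right hu.2 hR.le), rfl⟩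
  have hmem : (m k : ℝ) / n ∈ (fun u : ℝ => (m ⌊u * R⌋₊ : ℝ) / (n : ℝ)) '' Set.Icc s t := by
    refine ⟨k / R, ⟨(le_div_iff₀ hR).2 hks, (div_le_iff₀ hR).2 hkt⟩, ?_⟩
    simp only [div_mul_cancel₀ _ hR.ne', Nat.floor_natCast]
  have hlt := (le_csSup hbdd hmem).trans_lt hsup
  rw [div_lt_iff₀ (by exact_mod_cast hn)] at hlt
  have : 2 * m k < n := by
    have : (2 * m k : ℝ) < n := by linarith
    exact_mod_cast this
  omega

theorem mainTheorem9 {Ω : Type*} [MeasurableSpace Ω] (μ : Measure Ω) [IsProbabilityMeasure μ]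
    (p : ℝ) (hp0 : 0 < p) (hp : p < 1 / 2) (ρ : ℝ) (hρ : ρ = p / (1 - p))
    (C M : ℕ → Ω → ℕ)
    (hCM : IsMarkovChain (catMouse (reflectedWalk p)) (0, 0) (fun k ω => (C k ω, M k ω)) μ) :
    (∀ s t : ℝ, 0 < s → s < t →
      Tendsto (fun n : ℕ => μ.real {ω | 1 / 2 ≤ sSup
          ((fun u : ℝ => (M ⌊u * ρ ^ (-(n : ℤ))⌋₊ ω : ℝ) / (n : ℝ)) '' Set.Icc s t)})
        atTop (𝓝 1)) ∧
    (∀ᵐ ω ∂μ, ∃ᶠ k in atTop, M k ω = 0) := by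
  set θ : ℝ := 1 / (2 * p) with hθ
  have hpθ : p * θ = 1 / 2 := by rw [hθ]; field_simp
  have hθ1 : 1 < θ := by rw [hθ, lt_div_iff₀ (by positivity)]; linarith
  have hr : 1 < θ ^ 2 := one_lt_pow₀ hθ1 two_ne_zero
  have hpr : 1 - p < p * θ ^ 2 := by
    have h1 : p * θ ^ 2 = θ / 2 := by linear_combination θ * hpθ
    -- This is `4 * p * (1 - p) < 1` in disguise, the reason why `θ ^ 2 > 1 / ρ`.
    have h2 : 0 < (1 - 2 * p) ^ 2 * θ := by
      have : 0 < 1 - 2 * p := by linarith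
      positivity
    have h3 : (1 - 2 * p) ^ 2 * θ = θ - 2 * (1 - p) := by linear_combination (-4 + 4 * p) * hpθ
    linarith
  refine ⟨fun s t hs hst => ?_, catMouse_ae_frequently_eq_zero hp0 hp hr hpr hCM⟩
  obtain ⟨c, d, hcd⟩ := exists_mul_measure_stayEvent_le hp0 hp hr hpr hCM
  have h1p : 0 < 1 - p := by linarith
  have hρ0 : 0 < ρ := by rw [hρ]; positivity
  have hρ1 : ρ < 1 := by rw [hρ, div_lt_one h1p]; linarith
  have hθρ : θ * ρ < 1 := by
    rw [hρ, mul_div_assoc', div_lt_one h1p]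
    linarith
  have hρn : Tendsto (fun n : ℕ => ρ ^ n) atTop (𝓝 0) :=
    tendsto_pow_atTop_nhds_zero_of_lt_one hρ0.le hρ1
  have hθρn : Tendsto (fun n : ℕ => (θ * ρ) ^ n) atTop (𝓝 0) :=
    tendsto_pow_atTop_nhds_zero_of_lt_one (by positivity) hθρ
  have hlower : Tendsto (fun n : ℕ =>
      1 - (|c| * θ * (θ * ρ) ^ n + d * ρ ^ n) / ((t - s) - ρ ^ n)) atTop (𝓝 1) := by
    have := (((hθρn.const_mul (|c| * θ)).add (hρn.const_mul d)).div
      (tendsto_const_nhds.sub hρn) (by linarith : (t - s) - 0 ≠ 0)).const_sub 1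
    simpa using this
  refine tendsto_of_tendsto_of_tendsto_of_le_of_le' hlower tendsto_const_nhds ?_
    (Eventually.of_forall fun n => measureReal_le_one)
  filter_upwards [hρn.eventually_lt_const (sub_pos.2 hst), eventually_gt_atTop 0] with n hn hn0
  have hRn : ρ ^ (-(n : ℤ)) = (ρ ^ n)⁻¹ := by rw [zpow_neg, zpow_natCast]
  rw [hRn]
  set R : ℝ := (ρ ^ n)⁻¹ with hR_def
  have hR : 0 < R := by positivity
  have hRρ : R * ρ ^ n = 1 := inv_mul_cancel₀ (by positivity)
  have hlen : 1 < (t - s) * R := by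
    have := mul_lt_mul_of_pos_right hn hR
    linarith
  set G : Set Ω := {ω | 1 / 2 ≤ sSup
    ((fun u : ℝ => (M ⌊u * R⌋₊ ω : ℝ) / (n : ℝ)) '' Set.Icc s t)} with hG
  set k₀ : ℕ := ⌈s * R⌉₊ with hk₀
  set i : ℕ := ⌊t * R⌋₊ - k₀ with hi
  set A : Set Ω := stayEvent (fun k ω => (C k ω, M k ω)) {z | z.2 < (n + 1) / 2} k₀ i with hA
  have hk₀lt : (k₀ : ℝ) < s * R + 1 := Nat.ceil_lt_add_one (by positivity)
  have hk₀le : k₀ ≤ ⌊t * R⌋₊ := Nat.le_floor (by linarith)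
  have hcover : (Set.univ : Set Ω) ⊆ G ∪ A := by
    intro ω _
    by_cases hω : ω ∈ G
    · exact Or.inl hω
    · refine Or.inr fun j hj => ?_
      have hω' : sSup ((fun u : ℝ => (M ⌊u * R⌋₊ ω : ℝ) / (n : ℝ)) '' Set.Icc s t) < 1 / 2 :=
        not_le.1 hω
      refine lt_of_sSup_div_lt (m := fun k => M k ω) hn0 hR hω' ?_ ?_
      · exact (Nat.le_ceil _).trans (by exact_mod_cast Nat.le_add_right _ _)
      · refine (Nat.le_floor_iff (mul_nonneg (by linarith) hR.le)).1 ?_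
        omega
  have hone : 1 ≤ μ.real G + μ.real A := by
    calc (1 : ℝ) = μ.real Set.univ := by simp
      _ ≤ μ.real (G ∪ A) := measureReal_mono hcover
      _ ≤ _ := measureReal_union_le _ _
  have hi1 : (t - s) * R - 1 ≤ (i : ℝ) + 1 := by
    have h1 : t * R < ⌊t * R⌋₊ + 1 := Nat.lt_floor_add_one _
    rw [hi, Nat.cast_sub hk₀le]
    linarith
  -- The level is `n / 2` rounded up, which costs at most one extra factor `θ`.
  have hpow : (θ ^ 2) ^ ((n + 1) / 2) ≤ θ ^ (n + 1) := by
    rw [← pow_mul]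
    exact pow_le_pow_right₀ hθ1.le (by omega)
  have hAle : μ.real A ≤ (|c| * θ * (θ * ρ) ^ n + d * ρ ^ n) / ((t - s) - ρ ^ n) := by
    rw [le_div_iff₀ (by linarith)]
    have h1 : ((t - s) * R - 1) * μ.real A ≤ |c| * θ ^ (n + 1) + d :=
      calc _ ≤ ((i : ℝ) + 1) * μ.real A := mul_le_mul_of_nonneg_right hi1 measureReal_nonneg
        _ ≤ c * (θ ^ 2) ^ ((n + 1) / 2) + d := hcd _ _ _
        _ ≤ |c| * (θ ^ 2) ^ ((n + 1) / 2) + d := by gcongr; exact le_abs_self c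
        _ ≤ _ := by gcongr
    have h2 := mul_le_mul_of_nonneg_right h1 (pow_nonneg hρ0.le n)
    calc μ.real A * ((t - s) - ρ ^ n) = ((t - s) * R - 1) * μ.real A * ρ ^ n := by
          linear_combination (-(t - s) * μ.real A) * hRρ
      _ ≤ _ := h2
      _ = _ := by rw [mul_pow]; ring
  linarith
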